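/- Let $F,V$ be finite-dimensional complex normed spaces, let $N\ge 2$, $m\ge 0$, and let $L(D)=\sum_{|\gamma|=m} b_\gamma\,\partial^\gamma$, with $b_\gamma\in\mathrm{Hom}(F,V)$, be a homogeneous linear differential operator of order $m$ with constant coefficients on $\mathbb R^N$ from $F$ to $V$, with symbol $L(\xi)=\sum_{|\gamma|=m}\xi^\gamma b_\gamma$. The operator $L(D)$ is called cocanceling if $\bigcap_{\xi\in\mathbb R^N\setminus\{0\}}\ker L(\xi)=\{0\}$. For $0<\ell<N$ let $$I_\ell f(x)=\gamma_{N,\ell}\int_{\mathbb R^N}\frac{f(y)}{|x-y|^{N-\ell}}\,dy,\qquad \gamma_{N,\ell}=\pi^{\ell-\frac N2}\,\frac{\Gamma((N-\ell)/2)}{\Gamma(\ell/2)} .$$ Suppose that $0<\ell<N$, $0\le\alpha<1$, $\beta<N/q$, $\alpha+\beta>0$ and $\dfrac1q=1+\dfrac{\alpha+\beta-\ell}{N}$. (1) If $q\ge 1$ and $L(D)$ is cocanceling, then there exists $C>0$ such that $$\left(\int_{\mathbb R^N}|I_\ell f(x)|^q\,|x|^{-\beta q}\,dx\right)^{1/q}\le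 C\int_{\mathbb R^N}|x|^\alpha|f(x)|\,dx \qquad (*)$$ for all $f\in C_c^\infty(\mathbb R^N;F)$ such that $L(D)f=0$ in the sense of distributions. (2) Conversely, if $\alpha=0$ and there exists $C>0$ such that $(*)$ holds for all $f\in C_c^\infty(\mathbb R^N;F)$ with $L(D)f=0$, then $L(D)$ is cocanceling. -/

import Mathlib

open scoped ContDiff

noncomputable section

/-- The multi-indices `γ ∈ ℕ^N` of length `|γ| = γ₁ + ⋯ + γ_N = m`. -/
abbrev multiIndices (N m : ℕ) : Finset (Fin N → ℕ) :=
  Finset.piAntidiag Finset.univ m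

/-- The partial derivative `∂_i φ`. -/
def partialDeriv {N : ℕ} (i : Fin N) (φ : EuclideanSpace ℝ (Fin N) → ℝ) :
    EuclideanSpace ℝ (Fin N) → ℝ :=
  fun x => lineDeriv ℝ φ x (EuclideanSpace.single i 1)

/-- The iterated partial derivative `∂^γ φ = ∂_1^{γ₁} ⋯ ∂_N^{γ_N} φ`. -/
def multiDeriv {N : ℕ} (γ : Fin N → ℕ) (φ : EuclideanSpace ℝ (Fin N) → ℝ) :
    EuclideanSpace ℝ (Fin N) → ℝ :=
  (List.finRange N).foldr (fun i g => (partialDeriv i)^[γ i] g) φ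

/-- A homogeneous linear differential operator `L(D) = ∑_{|γ| = m} b_γ ∂^γ` of order `m` on `ℝ^N`
with constant coefficients `b_γ ∈ Hom(F, V)`, from the complex vector space `F` to the complex
vector space `V`. -/
structure HomDiffOp (N m : ℕ) (F V : Type*) [AddCommGroup F] [Module ℂ F]
    [AddCommGroup V] [Module ℂ V] where
  /-- The coefficients `b_γ`, for `|γ| = m`. -/
  coeff : multiIndices N m → (F →ₗ[ℂ] V)

namespace HomDiffOp

section Symbol

variable {N m : ℕ} {F V : Type*} [AddCommGroup F] [Module ℂ F] [AddCommGroup V] [Module ℂ V]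

/-- The symbol `L(ξ) = ∑_{|γ| = m} ξ^γ b_γ ∈ Hom(F, V)`, for `ξ ∈ ℝ^N`. -/
def symbol (L : HomDiffOp N m F V) (ξ : EuclideanSpace ℝ (Fin N)) : F →ₗ[ℂ] V :=
  ∑ γ : multiIndices N m, (((∏ i, ξ i ^ (γ.1 i) : ℝ)) : ℂ) • L.coeff γ

/-- `L(D)` is cocanceling: `⋂_{ξ ∈ ℝ^N \ {0}} ker L(ξ) = {0}`. -/
def Cocanceling (L : HomDiffOp N m F V) : Prop :=
  ⨅ ξ : {ξ : EuclideanSpace ℝ (Fin N) // ξ ≠ 0}, LinearMap.ker (L.symbol ξ.1) = ⊥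

end Symbol

/-- `L(D) f = 0` in the sense of distributions, i.e. the distribution
`φ ↦ ∑_{|γ| = m} (-1)^{|γ|} ∫ (∂^γ φ) b_γ f` vanishes on every test function `φ ∈ C_c^∞(ℝ^N)`.
(By linearity it makes no difference whether the test functions are real or complex valued.) -/
def DistribZero {N m : ℕ} {F V : Type*} [NormedAddCommGroup F] [NormedSpace ℂ F]
    [NormedAddCommGroup V] [NormedSpace ℂ V] (L : HomDiffOp N m F V)
    (f : EuclideanSpace ℝ (Fin N) → F) : Prop :=
  ∀ φ : EuclideanSpace ℝ (Fin N) → ℝ, ContDiff ℝ ∞ φ → HasCompactSupport φ →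
    ∑ γ : multiIndices N m,
      (-1 : ℝ) ^ m • ∫ x, (multiDeriv γ.1 φ x) • L.coeff γ (f x) = 0

end HomDiffOp

/-- The constant `γ_{N,ℓ} = π^{ℓ - N/2} Γ((N-ℓ)/2) / Γ(ℓ/2)`. -/
def rieszConst (N : ℕ) (ℓ : ℝ) : ℝ :=
  Real.pi ^ (ℓ - (N : ℝ) / 2) * Real.Gamma (((N : ℝ) - ℓ) / 2) / Real.Gamma (ℓ / 2)

/-- The Riesz potential `I_ℓ f(x) = γ_{N,ℓ} ∫ f(y) / |x - y|^{N-ℓ} dy`. -/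
def rieszPotential {N : ℕ} {F : Type*} [NormedAddCommGroup F] [NormedSpace ℂ F] (ℓ : ℝ)
    (f : EuclideanSpace ℝ (Fin N) → F) (x : EuclideanSpace ℝ (Fin N)) : F :=
  rieszConst N ℓ • ∫ y, (1 / ‖x - y‖ ^ ((N : ℝ) - ℓ)) • f y

/-- The inequality `(∫ |I_ℓ f(x)|^q |x|^{-βq} dx)^{1/q} ≤ C ∫ |x|^α |f(x)| dx`, between elements of
`[0, ∞]`. -/
def SteinWeissIneq {N : ℕ} {F : Type*} [NormedAddCommGroup F] [NormedSpace ℂ F]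
    (ℓ α β q C : ℝ) (f : EuclideanSpace ℝ (Fin N) → F) : Prop :=
  (∫⁻ x, ENNReal.ofReal (‖rieszPotential ℓ f x‖ ^ q * ‖x‖ ^ (-β * q))) ^ (1 / q)
    ≤ ENNReal.ofReal C * ∫⁻ x, ENNReal.ofReal (‖x‖ ^ α * ‖f x‖)

/-- There is a constant `C > 0` for which the inequality `SteinWeissIneq ℓ α β q C f` holds for all
`f ∈ C_c^∞(ℝ^N; F)` with `L(D) f = 0`. -/
def SteinWeissOnKernel {N m : ℕ} {F V : Type*} [NormedAddCommGroup F] [NormedSpace ℂ F]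
    [NormedAddCommGroup V] [NormedSpace ℂ V] (L : HomDiffOp N m F V) (ℓ α β q : ℝ) : Prop :=
  ∃ C : ℝ, 0 < C ∧ ∀ f : EuclideanSpace ℝ (Fin N) → F,
    ContDiff ℝ ∞ f → HasCompactSupport f → L.DistribZero f → SteinWeissIneq ℓ α β q C f

end

/-! Put s = N - ℓ, so that (s + α + β)q = N. Without a constraint on f, I_ℓ f behaves like |x|^{-s}
∫ f at infinity, which the weighted L^q norm does not tolerate. Cocancellation controls this leading
term.

Test L(D)f = 0 against (y/r)^δ/δ! ψ(y/r), with |δ| = m and ψ a bump equal to 1 near 0. Up to the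
factor r^{-m}, its γ-th derivative is ψ(y/r) if γ = δ and 0 otherwise, plus a remainder O(|y|/r)
supported in |y| ≲ r. Hence every b_δ ∫ ψ(y/r) f is bounded by ∫_{|y| ≲ r} (|y|/r)|f|, and joint
injectivity of the b_δ gives the same bound for ∫ ψ(y/r) f (`exists_norm_integral_bump_smul_le`).

With r = |x|, subtracting ψ(y/|x|)|x|^{-s} from the kernel leaves the positive kernel
`rieszMajorant`, which gains a factor |y|/|x| for |y| small against |x|. An L^1 to L^q bound for a
positive kernel only needs its L^q norm in x to be bounded uniformly in y
(`lintegral_rpow_lintegral_mul_le`). By homogeneity this is a matter of convergence: βq < N at x =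
0, α + β > 0 at x = y, α < 1 at infinity.

Conversely, a vector e killed by every L(ξ) is killed by every b_γ, so ψe is admissible. Its
potential is at least c|x|^{-s} for |x| > 1, and for α = 0 the left side diverges logarithmically.
-/

open MeasureTheory Metric Set

/-! ### Integrals of powers of the norm -/

section PowerIntegrals

variable {N : ℕ}

local notation "𝔼" => EuclideanSpace ℝ (Fin N)

theorem lintegral_eq_lintegral_comp_smul (g : 𝔼 → ENNReal) {r : ℝ} (hr : 0 < r) :
    ∫⁻ x, g x = ENNReal.ofReal (r ^ N) * ∫⁻ x, g (r • x) := by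
  have h1 : ∫⁻ x, g (r • x) = ∫⁻ x, g x ∂(Measure.map (fun x : 𝔼 => r • x) volume) :=
    ((Homeomorph.smulOfNeZero r hr.ne').measurableEmbedding.lintegral_map g).symm
  rw [h1, show (fun x : 𝔼 => r • x) = (r • ·) from rfl, Measure.map_addHaar_smul volume hr.ne',
    lintegral_smul_measure, smul_eq_mul, ← mul_assoc, ← ENNReal.ofReal_mul (by positivity)]
  have : r ^ N * |(r ^ Module.finrank ℝ 𝔼)⁻¹| = 1 := by
    rw [finrank_euclideanSpace_fin, abs_of_nonneg (by positivity)]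
    exact mul_inv_cancel₀ (by positivity)
  rw [this, ENNReal.ofReal_one, one_mul]

theorem setLIntegral_norm_rpow_smul (S : Set 𝔼) (hS : MeasurableSet S) (s : ℝ) {r : ℝ}
    (hr : 0 < r) :
    ∫⁻ x in S, ENNReal.ofReal (‖x‖ ^ (-s)) =
      ENNReal.ofReal (r ^ ((N : ℝ) - s)) *
        ∫⁻ x in (r • · : 𝔼 → 𝔼) ⁻¹' S, ENNReal.ofReal (‖x‖ ^ (-s)) := by
  have hS' : MeasurableSet ((r • · : 𝔼 → 𝔼) ⁻¹' S) := hS.preimage (measurable_const_smul r)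
  rw [← lintegral_indicator hS, ← lintegral_indicator hS', lintegral_eq_lintegral_comp_smul _ hr,
    sub_eq_add_neg, Real.rpow_add hr, Real.rpow_natCast, ENNReal.ofReal_mul (by positivity),
    mul_assoc]
  congr 1
  rw [← lintegral_const_mul' _ _ ENNReal.ofReal_ne_top]
  refine lintegral_congr fun x => ?_
  by_cases hx : r • x ∈ S
  · simp only [indicator, hx, mem_preimage, if_true]
    rw [← ENNReal.ofReal_mul (by positivity), norm_smul, Real.norm_of_nonneg hr.le,
      Real.mul_rpow hr.le (norm_nonneg _)]
  · simp [indicator, hx]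

/-- Scaling reduces to R = 1, where s < N makes the singularity integrable. -/
theorem exists_lintegral_closedBall_rpow_le (hN : 1 ≤ N) {s : ℝ} (hs : s < N) :
    ∃ C : ℝ, 0 ≤ C ∧ ∀ R : ℝ, 0 < R →
      ∫⁻ x in closedBall (0 : 𝔼) R, ENNReal.ofReal (‖x‖ ^ (-s)) ≤
        ENNReal.ofReal (C * R ^ ((N : ℝ) - s)) := by
  have hI : IntegrableOn (fun x : 𝔼 => ‖x‖ ^ (-s)) (ball 0 2) :=
    integrableOn_ball_of_norm_le_rpow (by simpa) (α := s) (C := 1) (by simpa)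
      (.of_forall fun x => by simp [abs_of_nonneg (Real.rpow_nonneg (norm_nonneg x) (-s))])
      (measurable_norm.pow_const _).aestronglyMeasurable
  have hfin : ∫⁻ x in closedBall (0 : 𝔼) 1, ENNReal.ofReal (‖x‖ ^ (-s)) ≠ ⊤ :=
    (hI.mono_set (closedBall_subset_ball (by norm_num))).lintegral_lt_top.ne
  refine ⟨(∫⁻ x in closedBall (0 : 𝔼) 1, ENNReal.ofReal (‖x‖ ^ (-s))).toReal,
    ENNReal.toReal_nonneg, fun R hR => ?_⟩
  rw [setLIntegral_norm_rpow_smul _ measurableSet_closedBall s hR,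
    mul_comm (ENNReal.toReal _), ENNReal.ofReal_mul (by positivity), ENNReal.ofReal_toReal hfin]
  gcongr
  intro x hx
  simp only [mem_preimage, mem_closedBall_zero_iff, norm_smul, Real.norm_of_nonneg hR.le] at hx ⊢
  exact (mul_le_iff_le_one_right hR).1 hx

/-- Polar coordinates turn this into integrability of t^{N-1-s} on (R, ∞). -/
theorem integrableOn_norm_rpow_iff (hN : 1 ≤ N) {s R : ℝ} (hR : 0 < R) :
    IntegrableOn (fun x : 𝔼 => ‖x‖ ^ (-s)) {x | R < ‖x‖} ↔ N < s := by
  have : Nontrivial 𝔼 := Module.nontrivial_of_finrank_pos (R := ℝ) (by simpa using by omega)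
  have h1 : MeasurableSet {x : 𝔼 | R < ‖x‖} := measurableSet_lt measurable_const measurable_norm
  rw [← integrable_indicator_iff h1]
  have h2 : ({x : 𝔼 | R < ‖x‖}.indicator fun x : 𝔼 => ‖x‖ ^ (-s)) =
      fun x : 𝔼 => (Ioi R).indicator (fun t : ℝ => t ^ (-s)) ‖x‖ := by
    ext x; simp [indicator]
  rw [h2, integrable_fun_norm_addHaar, finrank_euclideanSpace_fin,
    ← integrable_indicator_iff measurableSet_Ioi]
  have h3 : ((Ioi (0 : ℝ)).indicator fun y : ℝ =>
      y ^ (N - 1) • (Ioi R).indicator (fun t : ℝ => t ^ (-s)) y) =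
      (Ioi R).indicator fun y : ℝ => y ^ ((N : ℝ) - 1 - s) := by
    ext y
    by_cases hy : R < y
    · have hy0 : 0 < y := hR.trans hy
      simp only [indicator, mem_Ioi, hy, hy0, if_true, smul_eq_mul]
      rw [← Real.rpow_natCast, ← Real.rpow_add hy0, Nat.cast_sub hN, Nat.cast_one,
        ← sub_eq_add_neg]
    · simp [indicator, hy]
  rw [h3, integrable_indicator_iff measurableSet_Ioi, integrableOn_Ioi_rpow_iff hR]
  constructor <;> intro h <;> linarith

theorem exists_lintegral_compl_ball_rpow_le (hN : 1 ≤ N) {s : ℝ} (hs : N < s) :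
    ∃ C : ℝ, 0 ≤ C ∧ ∀ R : ℝ, 0 < R →
      ∫⁻ x in {x : 𝔼 | R ≤ ‖x‖}, ENNReal.ofReal (‖x‖ ^ (-s)) ≤
        ENNReal.ofReal (C * R ^ ((N : ℝ) - s)) := by
  have hfin : ∫⁻ x in {x : 𝔼 | 1 ≤ ‖x‖}, ENNReal.ofReal (‖x‖ ^ (-s)) ≠ ⊤ :=
    (((integrableOn_norm_rpow_iff hN (R := 1 / 2) (by norm_num)).2 hs).mono_set
      (fun x (hx : 1 ≤ ‖x‖) => show 1 / 2 < ‖x‖ by linarith)).lintegral_lt_top.ne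
  refine ⟨(∫⁻ x in {x : 𝔼 | 1 ≤ ‖x‖}, ENNReal.ofReal (‖x‖ ^ (-s))).toReal,
    ENNReal.toReal_nonneg, fun R hR => ?_⟩
  rw [setLIntegral_norm_rpow_smul _ (measurableSet_le measurable_const measurable_norm) s hR,
    mul_comm (ENNReal.toReal _), ENNReal.ofReal_mul (by positivity), ENNReal.ofReal_toReal hfin]
  gcongr
  intro x hx
  simp only [mem_preimage, mem_ofPred_eq, norm_smul, Real.norm_of_nonneg hR.le] at hx ⊢
  exact (le_mul_iff_one_le_right hR).1 hx

/-- The critical exponent: this logarithmic divergence contradicts the inequality in the converse.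
-/
theorem lintegral_norm_rpow_neg_dim_eq_top (hN : 1 ≤ N) {R : ℝ} (hR : 0 < R) :
    ∫⁻ x in {x : 𝔼 | R < ‖x‖}, ENNReal.ofReal (‖x‖ ^ (-(N : ℝ))) = ⊤ := by
  by_contra h
  have h1 : IntegrableOn (fun x : 𝔼 => ‖x‖ ^ (-(N : ℝ))) {x | R < ‖x‖} := by
    refine (lintegral_ofReal_ne_top_iff_integrable
      (measurable_norm.pow_const _).aestronglyMeasurable ?_).1 h
    exact .of_forall fun x => by positivity
  exact lt_irrefl _ ((integrableOn_norm_rpow_iff hN hR).1 h1)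

end PowerIntegrals

/-! ### Iterated partial derivatives and monomials -/

section MultiDeriv

variable {N : ℕ}

local notation "𝔼" => EuclideanSpace ℝ (Fin N)

/-- An operation on functions that is a composition of partial derivatives inherits every property
that partial derivatives preserve. -/
theorem multiDeriv_induction {P : (𝔼 → ℝ) → Prop} (hP : ∀ i φ, P φ → P (partialDeriv i φ))
    (γ : Fin N → ℕ) {φ : 𝔼 → ℝ} (hφ : P φ) : P (multiDeriv γ φ) := by
  unfold multiDeriv
  induction List.finRange N with
  | nil => simpa
  | cons i l ih =>
    simp only [List.foldr_cons]
    induction γ i with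
    | zero => simpa
    | succ k hk => rw [Function.iterate_succ_apply']; exact hP i _ hk

theorem contDiff_partialDeriv (i : Fin N) {φ : 𝔼 → ℝ} (hφ : ContDiff ℝ ∞ φ) :
    ContDiff ℝ ∞ (partialDeriv i φ) := by
  have : partialDeriv i φ = fun x => fderiv ℝ φ x (EuclideanSpace.single i 1) := by
    ext x
    exact ((hφ.differentiable (by simp)) x).lineDeriv_eq_fderiv
  rw [this]
  exact (hφ.fderiv_right (m := ∞) (by simp)).clm_apply contDiff_const

theorem contDiff_multiDeriv (γ : Fin N → ℕ) {φ : 𝔼 → ℝ} (hφ : ContDiff ℝ ∞ φ) :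
    ContDiff ℝ ∞ (multiDeriv γ φ) :=
  multiDeriv_induction (fun i _ => contDiff_partialDeriv i) γ hφ

theorem eqOn_partialDeriv (i : Fin N) {φ ψ : 𝔼 → ℝ} {U : Set 𝔼} (hU : IsOpen U)
    (h : EqOn φ ψ U) : EqOn (partialDeriv i φ) (partialDeriv i ψ) U := fun _ hx =>
  (h.eventuallyEq_of_mem (hU.mem_nhds hx)).lineDeriv_eq

theorem eqOn_multiDeriv (γ : Fin N → ℕ) {φ ψ : 𝔼 → ℝ} {U : Set 𝔼} (hU : IsOpen U)
    (h : EqOn φ ψ U) : EqOn (multiDeriv γ φ) (multiDeriv γ ψ) U := by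
  unfold multiDeriv
  induction List.finRange N with
  | nil => simpa
  | cons i l ih =>
    simp only [List.foldr_cons]
    induction γ i with
    | zero => simpa
    | succ k hk =>
      rw [Function.iterate_succ_apply', Function.iterate_succ_apply']
      exact eqOn_partialDeriv i hU hk

theorem multiDeriv_zero (γ : Fin N → ℕ) : multiDeriv γ (0 : 𝔼 → ℝ) = 0 :=
  multiDeriv_induction (P := fun φ => φ = 0)
    (fun i φ h => by subst h; ext x; simp [partialDeriv, lineDeriv]) γ rfl

theorem partialDeriv_const_mul_comp_smul (i : Fin N) (φ : 𝔼 → ℝ) (a c : ℝ) :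
    partialDeriv i (fun x => a * φ (c • x)) = fun x => (a * c) * partialDeriv i φ (c • x) := by
  ext x
  simp only [partialDeriv, lineDeriv, smul_add, smul_smul, deriv_const_mul_field]
  have := deriv_comp_mul_left c
    (fun t : ℝ => φ (c • x + t • EuclideanSpace.single i (1 : ℝ))) 0
  simp only [mul_zero, smul_eq_mul] at this
  rw [this, mul_assoc]

/-- The factor depends only on |γ|, so it is common to all terms of a homogeneous operator and drops
out of L(D)f = 0. -/
theorem multiDeriv_comp_smul (γ : Fin N → ℕ) (φ : 𝔼 → ℝ) (c : ℝ) :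
    multiDeriv γ (fun x => φ (c • x)) = fun x => c ^ (∑ i, γ i) * multiDeriv γ φ (c • x) := by
  have key : ∀ l : List (Fin N), l.foldr (fun i g => (partialDeriv i)^[γ i] g)
      (fun x => φ (c • x)) = fun x => c ^ (l.map γ).sum *
        l.foldr (fun i g => (partialDeriv i)^[γ i] g) φ (c • x) := by
    intro l
    induction l with
    | nil => simp
    | cons i l ih =>
      simp only [List.foldr_cons, List.map_cons, List.sum_cons, ih]
      induction γ i with
      | zero => simp
      | succ k hk =>
        rw [Function.iterate_succ_apply', Function.iterate_succ_apply', hk,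
          partialDeriv_const_mul_comp_smul]
        ext x; ring
  rw [multiDeriv, key, ← List.sum_ofFn, List.ofFn_eq_map]
  rfl

/-- The function `x ↦ ∏ i, p i (x i)`. -/
noncomputable def tensorPoly (p : Fin N → Polynomial ℝ) : 𝔼 → ℝ := fun x => ∏ i, (p i).eval (x i)

theorem contDiff_tensorPoly (p : Fin N → Polynomial ℝ) : ContDiff ℝ ∞ (tensorPoly p) := by
  unfold tensorPoly
  refine contDiff_prod fun i _ => ?_
  have h : ContDiff ℝ ∞ fun x : 𝔼 => x i := (EuclideanSpace.proj (𝕜 := ℝ) i).contDiff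
  have := ((p i).contDiff_aeval (𝕜 := ℝ) ∞).comp h
  simpa [Function.comp_def] using this

theorem partialDeriv_tensorPoly (i : Fin N) (p : Fin N → Polynomial ℝ) :
    partialDeriv i (tensorPoly p) =
      tensorPoly (Function.update p i (Polynomial.derivative (p i))) := by
  ext x
  have h : (fun t : ℝ => tensorPoly p (x + t • EuclideanSpace.single i (1 : ℝ))) =
      fun t : ℝ => (p i).eval (x i + t) * ∏ j ∈ Finset.univ.erase i, (p j).eval (x j) := by
    ext t
    rw [tensorPoly, ← Finset.mul_prod_erase _ _ (Finset.mem_univ i)]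
    congr 1
    · simp
    · refine Finset.prod_congr rfl fun j hj => ?_
      simp [(Finset.ne_of_mem_erase hj)]
  rw [partialDeriv, lineDeriv, h, deriv_mul_const_field, deriv_comp_const_add (fun t => (p i).eval t),
    add_zero, Polynomial.deriv, tensorPoly, ← Finset.mul_prod_erase _ _ (Finset.mem_univ i)]
  congr 1
  · simp
  · refine Finset.prod_congr rfl fun j hj => ?_
    simp [(Finset.ne_of_mem_erase hj)]

theorem multiDeriv_tensorPoly (γ : Fin N → ℕ) (p : Fin N → Polynomial ℝ) :
    multiDeriv γ (tensorPoly p) = tensorPoly fun i => Polynomial.derivative^[γ i] (p i) := by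
  have key : ∀ l : List (Fin N), l.Nodup →
      l.foldr (fun i g => (partialDeriv i)^[γ i] g) (tensorPoly p) =
        tensorPoly fun i => if i ∈ l then Polynomial.derivative^[γ i] (p i) else p i := by
    intro l hl
    induction l with
    | nil => simp
    | cons i l ih =>
      rw [List.nodup_cons] at hl
      rw [List.foldr_cons, ih hl.2]
      have h : ∀ k : ℕ, (partialDeriv i)^[k] (tensorPoly fun j =>
          if j ∈ l then Polynomial.derivative^[γ j] (p j) else p j) =
          tensorPoly (Function.update (fun j =>
          if j ∈ l then Polynomial.derivative^[γ j] (p j) else p j) i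
            (Polynomial.derivative^[k] (p i))) := by
        intro k
        induction k with
        | zero =>
          refine congrArg tensorPoly (funext fun j => ?_)
          rcases eq_or_ne j i with rfl | hj
          · simp [hl.1]
          · simp [hj]
        | succ k hk =>
          rw [Function.iterate_succ_apply', hk, partialDeriv_tensorPoly]
          simp [← Function.iterate_succ_apply', -Function.iterate_succ]
      rw [h]
      refine congrArg tensorPoly (funext fun j => ?_)
      rcases eq_or_ne j i with rfl | hj
      · simp
      · simp [hj]
  rw [multiDeriv, key _ (List.nodup_finRange N)]
  simp

/-- The normalized monomial `x^γ / γ!`. -/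
noncomputable def normMonomial (γ : Fin N → ℕ) : 𝔼 → ℝ :=
  tensorPoly fun i => Polynomial.C (((γ i).factorial : ℝ)⁻¹) * Polynomial.X ^ γ i

/-- Normalized monomials of degree m are dual to the derivatives of order m, so testing with one
isolates a single coefficient b_δ. Off the diagonal, equal lengths force γ_i > δ_i for some i, and
that many derivatives kill x_i^{δ_i}. -/
theorem multiDeriv_normMonomial {m : ℕ} (γ δ : multiIndices N m) :
    multiDeriv γ.1 (normMonomial δ.1) = fun _ => if γ = δ then 1 else 0 := by
  ext x
  rw [normMonomial, multiDeriv_tensorPoly, tensorPoly]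
  split_ifs with h
  · subst h
    refine Finset.prod_eq_one fun i _ => ?_
    rw [Polynomial.iterate_derivative_C_mul, Polynomial.iterate_derivative_X_pow_eq_C_mul]
    simp [Nat.descFactorial_self, Nat.factorial_ne_zero]
  · obtain ⟨i, hi⟩ : ∃ i, δ.1 i < γ.1 i := by
      by_contra! hle
      refine h (Subtype.ext (funext fun i => ?_))
      have hs : ∑ i, γ.1 i = ∑ i, δ.1 i :=
        (Finset.mem_piAntidiag.1 γ.2).1.trans (Finset.mem_piAntidiag.1 δ.2).1.symm
      exact (Finset.sum_eq_sum_iff_of_le fun i _ => hle i).1 hs i (Finset.mem_univ i)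
    refine Finset.prod_eq_zero (Finset.mem_univ i) ?_
    rw [Polynomial.iterate_derivative_C_mul, Polynomial.iterate_derivative_X_pow_eq_C_mul,
      Nat.descFactorial_of_lt hi]
    simp

end MultiDeriv

/-! ### Cocancellation controls truncated means -/

section MomentBound

variable {N m : ℕ}

local notation "𝔼" => EuclideanSpace ℝ (Fin N)

theorem HomDiffOp.Cocanceling.ker_pi_coeff {F V : Type*} [AddCommGroup F] [Module ℂ F]
    [AddCommGroup V] [Module ℂ V] {L : HomDiffOp N m F V} (hL : L.Cocanceling) :
    LinearMap.ker (LinearMap.pi L.coeff) = ⊥ := by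
  rw [eq_bot_iff, ← hL]
  intro e he
  have h : ∀ γ, L.coeff γ e = 0 := fun γ => congrFun he γ
  simp [Submodule.mem_iInf, HomDiffOp.symbol, h]

/-- The remainder vanishes where ψ = 1 near the origin, by duality of monomials, and outside the
support of ψ. In between it is bounded by some M, and M ≤ (M / rIn)|y| there. -/
theorem exists_remainder_bound (ψ : ContDiffBump (0 : 𝔼)) (γ δ : multiIndices N m) :
    ∃ C : ℝ, 0 ≤ C ∧ ∀ y : 𝔼,
      |multiDeriv γ.1 (fun x => normMonomial δ.1 x * ψ x) y - if γ = δ then ψ y else 0| ≤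
        {y : 𝔼 | ‖y‖ ≤ ψ.rOut}.indicator (fun y => C * ‖y‖) y := by
  set R : 𝔼 → ℝ := fun y =>
    multiDeriv γ.1 (fun x => normMonomial δ.1 x * ψ x) y - if γ = δ then ψ y else 0 with hR
  have hsm : ContDiff ℝ ∞ fun x => normMonomial δ.1 x * ψ x :=
    (contDiff_tensorPoly _).mul ψ.contDiff
  have hin : ∀ y : 𝔼, ‖y‖ < ψ.rIn → R y = 0 := by
    intro y hy
    have h1 : EqOn (fun x => normMonomial δ.1 x * ψ x) (normMonomial δ.1) (ball (0 : 𝔼) ψ.rIn) :=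
      fun x hx => by simp [ψ.one_of_mem_closedBall (ball_subset_closedBall hx)]
    have hy' : y ∈ ball (0 : 𝔼) ψ.rIn := by simpa using hy
    simp only [hR]
    rw [eqOn_multiDeriv γ.1 isOpen_ball h1 hy', multiDeriv_normMonomial,
      ψ.one_of_mem_closedBall (ball_subset_closedBall hy'), sub_self]
  have hout : ∀ y : 𝔼, ψ.rOut < ‖y‖ → R y = 0 := by
    intro y hy
    have h0 : ∀ x : 𝔼, ψ.rOut ≤ ‖x‖ → ψ x = 0 := fun x hx =>
      ψ.zero_of_le_dist (by simpa using hx)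
    have h1 : EqOn (fun x => normMonomial δ.1 x * ψ x) 0 {x : 𝔼 | ψ.rOut < ‖x‖} :=
      fun x hx => by simp [h0 x (le_of_lt hx)]
    simp only [hR]
    rw [eqOn_multiDeriv γ.1 (isOpen_lt continuous_const continuous_norm) h1 hy, multiDeriv_zero,
      h0 y hy.le]
    simp
  have hc : Continuous R := by
    refine (contDiff_multiDeriv γ.1 hsm).continuous.sub ?_
    split_ifs
    exacts [ψ.continuous, continuous_const]
  obtain ⟨M, hM⟩ := (isCompact_closedBall (0 : 𝔼) ψ.rOut).exists_bound_of_continuousOn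
    hc.continuousOn
  have hM0 : 0 ≤ M := (norm_nonneg _).trans (hM 0 (mem_closedBall_self ψ.rOut_pos.le))
  refine ⟨M / ψ.rIn, div_nonneg hM0 ψ.rIn_pos.le, fun y => ?_⟩
  change |R y| ≤ _
  by_cases hy : ‖y‖ ≤ ψ.rOut
  · rw [indicator_of_mem (by exact hy)]
    rcases lt_or_ge ‖y‖ ψ.rIn with h | h
    · rw [hin y h, abs_zero]
      exact mul_nonneg (div_nonneg hM0 ψ.rIn_pos.le) (norm_nonneg _)
    · refine (hM y (by simpa using hy)).trans ?_
      rw [div_mul_eq_mul_div, le_div_iff₀ ψ.rIn_pos]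
      gcongr
  · rw [indicator_of_notMem (by exact hy), hout y (not_le.1 hy), abs_zero]

/-- The constant is uniform in the scale r, which is later taken to be |x|. The gain |y|/r replaces
the cancellation that a vanishing integral of f would give. -/
theorem HomDiffOp.Cocanceling.exists_norm_integral_bump_smul_le {F V : Type*}
    [NormedAddCommGroup F] [NormedSpace ℂ F] [FiniteDimensional ℂ F]
    [NormedAddCommGroup V] [NormedSpace ℂ V] [FiniteDimensional ℂ V]
    {L : HomDiffOp N m F V} (hL : L.Cocanceling) (ψ : ContDiffBump (0 : 𝔼)) :
    ∃ C : ℝ, 0 ≤ C ∧ ∀ f : 𝔼 → F, Continuous f → HasCompactSupport f → L.DistribZero f →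
      ∀ r : ℝ, 0 < r → ‖∫ y, ψ (r⁻¹ • y) • f y‖ ≤
        C * ∫ y, {y : 𝔼 | ‖y‖ ≤ ψ.rOut * r}.indicator (fun y => ‖y‖ / r * ‖f y‖) y := by
  choose C hC0 hC using exists_remainder_bound (m := m) ψ
  -- An injective linear map on a finite-dimensional space is bounded below; K is the inverse bound.
  obtain ⟨K, -, hK⟩ := (LinearMap.pi L.coeff).exists_antilipschitzWith hL.ker_pi_coeff
  let B : multiIndices N m → F →L[ℂ] V := fun γ => (L.coeff γ).toContinuousLinearMap
  refine ⟨K * ∑ δ, ∑ γ, ‖B γ‖ * C γ δ,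
    mul_nonneg K.coe_nonneg (Finset.sum_nonneg fun δ _ => Finset.sum_nonneg fun γ _ =>
      mul_nonneg (norm_nonneg _) (hC0 γ δ)), fun f hf hfs hLf r hr => ?_⟩
  set J : ℝ := ∫ y, {y : 𝔼 | ‖y‖ ≤ ψ.rOut * r}.indicator (fun y => ‖y‖ / r * ‖f y‖) y with hJ
  have hJint : Integrable ({y : 𝔼 | ‖y‖ ≤ ψ.rOut * r}.indicator fun y => ‖y‖ / r * ‖f y‖) := by
    refine Integrable.indicator ?_ (measurableSet_le measurable_norm measurable_const)
    refine Continuous.integrable_of_hasCompactSupport (by fun_prop) ?_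
    exact hfs.norm.mul_left
  let R : multiIndices N m → multiIndices N m → 𝔼 → ℝ := fun γ δ y =>
    multiDeriv γ.1 (fun x => normMonomial δ.1 x * ψ x) y - if γ = δ then ψ y else 0
  let v : multiIndices N m → multiIndices N m → F := fun γ δ => ∫ y, R γ δ (r⁻¹ • y) • f y
  have hv : ∀ γ δ, ‖v γ δ‖ ≤ C γ δ * J := by
    intro γ δ
    rw [hJ, ← integral_const_mul]
    refine norm_integral_le_of_norm_le (hJint.const_mul _) (.of_forall fun y => ?_)
    rw [norm_smul, Real.norm_eq_abs]
    refine (mul_le_mul_of_nonneg_right (hC γ δ (r⁻¹ • y)) (norm_nonneg _)).trans_eq ?_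
    have hiff : ‖r⁻¹ • y‖ ≤ ψ.rOut ↔ ‖y‖ ≤ ψ.rOut * r := by
      rw [norm_smul, norm_inv, Real.norm_of_nonneg hr.le, inv_mul_le_iff₀ hr, mul_comm]
    by_cases h : ‖y‖ ≤ ψ.rOut * r
    · rw [indicator_of_mem (by exact hiff.2 h), indicator_of_mem (by exact h), norm_smul, norm_inv,
        Real.norm_of_nonneg hr.le]
      ring
    · rw [indicator_of_notMem (by exact fun h' => h (hiff.1 h')), indicator_of_notMem (by exact h)]
      simp
  set u : F := ∫ y, ψ (r⁻¹ • y) • f y with hu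
  have hint : ∀ φ : 𝔼 → ℝ, Continuous φ → Integrable fun y => φ (r⁻¹ • y) • f y := fun φ hφ =>
    Continuous.integrable_of_hasCompactSupport (by fun_prop) hfs.smul_left
  have hB : ∀ (γ) (φ : 𝔼 → ℝ), Continuous φ →
      ∫ y, φ (r⁻¹ • y) • L.coeff γ (f y) = B γ (∫ y, φ (r⁻¹ • y) • f y) := by
    intro γ φ hφ
    rw [← ContinuousLinearMap.integral_comp_comm _ (hint φ hφ)]
    refine integral_congr_ae (.of_forall fun y => ?_)
    exact ((L.coeff γ).map_smul_of_tower (φ (r⁻¹ • y)) (f y)).symm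
  have hsm : ∀ δ : multiIndices N m, ContDiff ℝ ∞ fun x => normMonomial δ.1 x * ψ x := fun δ =>
    (contDiff_tensorPoly _).mul ψ.contDiff
  -- Test L(D)f = 0 with the truncated monomial at scale r: the diagonal term gives b_δ u, the
  -- remainders give the right side.
  have key : ∀ δ, B δ u = -∑ γ, B γ (v γ δ) := by
    intro δ
    have h1 := hLf (fun y => normMonomial δ.1 (r⁻¹ • y) * ψ (r⁻¹ • y))
      ((hsm δ).comp (contDiff_const_smul _)) ?_
    · have h2 : ∀ γ : multiIndices N m,
          ∫ y, multiDeriv γ.1 (fun y => normMonomial δ.1 (r⁻¹ • y) * ψ (r⁻¹ • y)) y •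
            L.coeff γ (f y) = (r⁻¹) ^ m • (B γ (v γ δ) + if γ = δ then B γ u else 0) := by
        intro γ
        rw [multiDeriv_comp_smul γ.1 (fun x => normMonomial δ.1 x * ψ x),
          (Finset.mem_piAntidiag.1 γ.2).1]
        simp only [mul_smul]
        rw [integral_smul, hB γ _ (contDiff_multiDeriv γ.1 (hsm δ)).continuous]
        congr 1
        have h3 : ∫ y, multiDeriv γ.1 (fun x => normMonomial δ.1 x * ψ x) (r⁻¹ • y) • f y =
            v γ δ + if γ = δ then u else 0 := by
          have h4 : Continuous fun y => if γ = δ then ψ y else 0 := by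
            split_ifs
            exacts [ψ.continuous, continuous_const]
          have h5 : (if γ = δ then u else 0) =
              ∫ y, (if γ = δ then ψ (r⁻¹ • y) else 0) • f y := by
            split_ifs <;> simp [hu]
          have h6 : Continuous (R γ δ) := (contDiff_multiDeriv γ.1 (hsm δ)).continuous.sub h4
          rw [h5]
          change _ = (∫ y, R γ δ (r⁻¹ • y) • f y) + _
          rw [← integral_add (hint _ h6) (hint _ h4)]
          refine integral_congr_ae (.of_forall fun y => ?_)
          simp only [R, ← add_smul, sub_add_cancel]
        rw [h3, map_add]
        split_ifs <;> simp
      simp only [h2, ← Finset.smul_sum] at h1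
      -- The common nonzero factor (-1)^m r^{-m} is cancelled.
      rw [smul_smul, smul_eq_zero_iff_right (by positivity), Finset.sum_add_distrib,
        Finset.sum_ite_eq' Finset.univ δ] at h1
      simpa using eq_neg_of_add_eq_zero_right h1
    · have h3 : HasCompactSupport fun x => normMonomial δ.1 x * ψ x :=
        ψ.hasCompactSupport.mul_left
      exact h3.comp_homeomorph (Homeomorph.smulOfNeZero r⁻¹ (by positivity))
  have h1 : ‖u‖ ≤ K * ‖LinearMap.pi L.coeff u‖ := by
    simpa using hK.le_mul_dist u 0
  refine h1.trans ?_
  rw [mul_assoc]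
  gcongr
  rw [Finset.sum_mul]
  have h2 : ∀ δ, ‖L.coeff δ u‖ ≤ (∑ γ, ‖B γ‖ * C γ δ) * J := by
    intro δ
    change ‖B δ u‖ ≤ _
    rw [key, norm_neg, Finset.sum_mul]
    refine norm_sum_le_of_le _ fun γ _ => ?_
    rw [mul_assoc]
    exact ((B γ).le_opNorm _).trans (mul_le_mul_of_nonneg_left (hv γ δ) (norm_nonneg _))
  have h0 : ∀ δ, 0 ≤ (∑ γ, ‖B γ‖ * C γ δ) * J := fun δ => (norm_nonneg _).trans (h2 δ)
  refine (pi_norm_le_iff_of_nonneg (Finset.sum_nonneg fun δ _ => h0 δ)).2 fun δ => ?_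
  exact (h2 δ).trans (Finset.single_le_sum (fun δ _ => h0 δ) (Finset.mem_univ δ))

end MomentBound

/-! ### An L^1 to L^q bound for positive kernels -/

section IntegralInequality

theorem lintegral_rpow_le_measure_univ_mul {β : Type*} [MeasurableSpace β] (ν : Measure β)
    {q : ℝ} (hq : 1 ≤ q) {h : β → ENNReal} (hh : Measurable h) :
    (∫⁻ y, h y ∂ν) ^ q ≤ ν univ ^ (q - 1) * ∫⁻ y, h y ^ q ∂ν := by
  have hq0 : 0 < q := zero_lt_one.trans_le hq
  -- For q = 1 the conjugate exponent is infinite, so Hölder is used only for q > 1.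
  rcases hq.eq_or_lt with rfl | hq1
  · simp
  have hpq : q.HolderConjugate (q / (q - 1)) := Real.HolderConjugate.conjExponent hq1
  have h1 := ENNReal.lintegral_mul_le_Lp_mul_Lq ν hpq hh.aemeasurable
    (aemeasurable_const (b := (1 : ENNReal)))
  simp only [Pi.mul_apply, mul_one, ENNReal.one_rpow, lintegral_const, one_mul] at h1
  refine (ENNReal.rpow_le_rpow h1 hq0.le).trans_eq ?_
  rw [ENNReal.mul_rpow_of_nonneg _ _ hq0.le, ← ENNReal.rpow_mul, ← ENNReal.rpow_mul,
    one_div_mul_cancel hq0.ne', ENNReal.rpow_one, mul_comm]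
  congr 2
  field_simp

/-- A form of Minkowski's integral inequality: absorb g into the measure g ν, apply Hölder against
its total mass, and exchange the integrals by Tonelli. -/
theorem lintegral_rpow_lintegral_mul_le {α β : Type*} [MeasurableSpace α] [MeasurableSpace β]
    (μ : Measure α) [SFinite μ] (ν : Measure β) [SFinite ν] {q : ℝ} (hq : 1 ≤ q)
    {h : α → β → ENNReal} (hh : Measurable (Function.uncurry h)) {g : β → ENNReal}
    (hg : Measurable g) {A : ENNReal} (hA : ∀ᵐ y ∂ν, ∫⁻ x, h x y ^ q ∂μ ≤ A) :
    ∫⁻ x, (∫⁻ y, h x y * g y ∂ν) ^ q ∂μ ≤ A * (∫⁻ y, g y ∂ν) ^ q := by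
  have hq0 : 0 < q := zero_lt_one.trans_le hq
  set ν' := ν.withDensity g
  have huniv : ν' univ = ∫⁻ y, g y ∂ν := by simp [ν']
  have hx : ∀ x, Measurable (h x) := fun x => hh.comp measurable_prodMk_left
  calc ∫⁻ x, (∫⁻ y, h x y * g y ∂ν) ^ q ∂μ
      = ∫⁻ x, (∫⁻ y, h x y ∂ν') ^ q ∂μ := by
        refine lintegral_congr fun x => ?_
        rw [lintegral_withDensity_eq_lintegral_mul _ hg (hx x)]
        simp [mul_comm]
    _ ≤ ∫⁻ x, ν' univ ^ (q - 1) * ∫⁻ y, h x y ^ q ∂ν' ∂μ :=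
        lintegral_mono fun x => lintegral_rpow_le_measure_univ_mul ν' hq (hx x)
    _ = ν' univ ^ (q - 1) * ∫⁻ y, ∫⁻ x, h x y ^ q ∂μ ∂ν' := by
        have hm : Measurable (Function.uncurry fun x y => h x y ^ q) := hh.pow_const q
        rw [lintegral_const_mul (f := fun x => ∫⁻ y, h x y ^ q ∂ν') _ hm.lintegral_prod_right',
          lintegral_lintegral_swap hm.aemeasurable]
    _ ≤ ν' univ ^ (q - 1) * ∫⁻ _, A ∂ν' := by
        gcongr 1
        exact lintegral_mono_ae ((withDensity_absolutelyContinuous ν g).ae_le hA)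
    _ = A * (∫⁻ y, g y ∂ν) ^ q := by
        have hG : (∫⁻ y, g y ∂ν) ^ q = (∫⁻ y, g y ∂ν) ^ (q - 1) * ∫⁻ y, g y ∂ν := by
          conv_lhs => rw [show q = (q - 1) + 1 by ring]
          rw [ENNReal.rpow_add_of_nonneg _ _ (by linarith) zero_le_one, ENNReal.rpow_one]
        rw [lintegral_const, huniv, hG]
        ring

end IntegralInequality

/-! ### The corrected Riesz kernel -/

section Majorant

/-- Mean value inequality on [b/2, ∞), where the derivative is at most s(b/2)^{-s-1} = s 2^{s+1}
b^{-s-1}. -/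
theorem abs_rpow_neg_sub_rpow_neg_le {s a b : ℝ} (hs : 0 < s) (hb : 0 < b) (hab : b / 2 ≤ a) :
    |a ^ (-s) - b ^ (-s)| ≤ s * 2 ^ (s + 1) * b ^ (-s - 1) * |a - b| := by
  have hpos : ∀ t ∈ Ici (b / 2), 0 < t := fun t ht => (half_pos hb).trans_le ht
  have h := (convex_Ici (b / 2)).norm_image_sub_le_of_norm_hasDerivWithin_le
    (f := fun t : ℝ => t ^ (-s)) (f' := fun t => -s * t ^ (-s - 1))
    (C := s * 2 ^ (s + 1) * b ^ (-s - 1))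
    (fun t ht => (Real.hasDerivAt_rpow_const (Or.inl (hpos t ht).ne')).hasDerivWithinAt) ?_
    (show b ∈ Ici (b / 2) by simpa using by linarith) (show a ∈ Ici (b / 2) from hab)
  · simpa using h
  · intro t ht
    have h1 : t ^ (-s - 1) ≤ (b / 2) ^ (-s - 1) :=
      Real.rpow_le_rpow_of_nonpos (half_pos hb) ht (by linarith)
    rw [norm_mul, norm_neg, Real.norm_of_nonneg hs.le,
      Real.norm_of_nonneg (Real.rpow_nonneg (hpos t ht).le _), mul_assoc]
    gcongr
    refine h1.trans_eq ?_
    rw [div_eq_inv_mul, Real.mul_rpow (by norm_num) hb.le, Real.inv_rpow (by norm_num),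
      ← Real.rpow_neg (by norm_num)]
    congr 2
    ring

variable {E : Type*} [NormedAddCommGroup E]

/-- A kernel that dominates `‖x - y‖ ^ (-s)`, corrected by `‖x‖ ^ (-s)` for `‖y‖` small compared to
`‖x‖`. -/
noncomputable def rieszMajorant (s : ℝ) (x y : E) : ℝ :=
  if ‖x‖ ≤ 4 * ‖y‖ then ‖x - y‖ ^ (-s) else ‖y‖ * ‖x‖ ^ (-s - 1)

theorem rieszMajorant_nonneg (s : ℝ) (x y : E) : 0 ≤ rieszMajorant s x y := by
  unfold rieszMajorant
  split_ifs <;> positivity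

theorem measurable_rieszMajorant [MeasurableSpace E] [BorelSpace E] [SecondCountableTopology E]
    (s : ℝ) : Measurable (Function.uncurry (rieszMajorant s : E → E → ℝ)) := by
  refine Measurable.ite (measurableSet_le (by fun_prop) (by fun_prop)) ?_ ?_
  · exact (by fun_prop : Measurable fun p : E × E => ‖p.1 - p.2‖).pow_const _
  · exact (by fun_prop : Measurable fun p : E × E => ‖p.2‖).mul
      ((by fun_prop : Measurable fun p : E × E => ‖p.1‖).pow_const _)

theorem rpow_neg_norm_le_of_norm_le_half {s : ℝ} (hs : 0 < s) {x y : E} (hx : x ≠ 0)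
    (hy : 2 * ‖y‖ ≤ ‖x‖) : ‖x‖ ^ (-s) ≤ 2 ^ s * ‖x - y‖ ^ (-s) := by
  have hx0 := norm_pos_iff.2 hx
  have h1 : ‖x‖ - ‖y‖ ≤ ‖x - y‖ := norm_sub_norm_le x y
  have h2 : ‖x - y‖ ≤ ‖x‖ + ‖y‖ := norm_sub_le x y
  have h3 : (2 * ‖x‖) ^ (-s) ≤ ‖x - y‖ ^ (-s) :=
    Real.rpow_le_rpow_of_nonpos (by linarith) (by linarith [norm_nonneg y]) (by linarith)
  rw [Real.mul_rpow (by norm_num) hx0.le, Real.rpow_neg (by norm_num)] at h3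
  rwa [inv_mul_le_iff₀ (by positivity)] at h3

theorem mul_rpow_le_rieszMajorant {s : ℝ} (hs : 0 < s) {x y : E} (hx : x ≠ 0)
    (hy : 2 * ‖y‖ ≤ ‖x‖) : ‖y‖ * ‖x‖ ^ (-s - 1) ≤ 2 ^ s * rieszMajorant s x y := by
  have hx0 := norm_pos_iff.2 hx
  unfold rieszMajorant
  split_ifs with h
  · refine le_trans ?_ (rpow_neg_norm_le_of_norm_le_half hs hx hy)
    rw [Real.rpow_sub_one hx0.ne', mul_div_assoc', div_le_iff₀ hx0, mul_comm]
    gcongr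
    linarith [norm_nonneg y]
  · exact le_mul_of_one_le_left (by positivity) (Real.one_le_rpow (by norm_num) hs.le)

/-- Here c stands for the cutoff ψ(y/|x|). If |x| ≤ 4|y|, the two terms are bounded separately, the
second being zero unless 2|y| ≤ |x|. Otherwise c = 1 and the mean value bound gives the factor
|y|/|x|. -/
theorem abs_kernel_sub_le_rieszMajorant {s : ℝ} (hs : 0 < s) {x y : E} (hx : x ≠ 0) {c : ℝ}
    (hc0 : 0 ≤ c) (hc1 : c ≤ 1) (hin : 4 * ‖y‖ < ‖x‖ → c = 1) (hout : ‖x‖ < 2 * ‖y‖ → c = 0) :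
    |‖x - y‖ ^ (-s) - c * ‖x‖ ^ (-s)| ≤
      (1 + 2 ^ s + s * 2 ^ (s + 1)) * rieszMajorant s x y := by
  have hx0 := norm_pos_iff.2 hx
  have hs2 : (0 : ℝ) ≤ s * 2 ^ (s + 1) := by positivity
  have h2s : (0 : ℝ) ≤ 2 ^ s := by positivity
  unfold rieszMajorant
  split_ifs with h
  · have h1 : c * ‖x‖ ^ (-s) ≤ 2 ^ s * ‖x - y‖ ^ (-s) := by
      rcases le_or_gt (2 * ‖y‖) ‖x‖ with h' | h'
      · exact (mul_le_of_le_one_left (by positivity) hc1).trans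
          (rpow_neg_norm_le_of_norm_le_half hs hx h')
      · rw [hout h', zero_mul]
        positivity
    have h2 : 0 ≤ ‖x - y‖ ^ (-s) := by positivity
    have h3 : 0 ≤ c * ‖x‖ ^ (-s) := by positivity
    refine (abs_sub _ _).trans ?_
    rw [abs_of_nonneg h2, abs_of_nonneg h3]
    nlinarith [mul_nonneg hs2 h2]
  · have h' := not_le.1 h
    have h1 : ‖x‖ - ‖y‖ ≤ ‖x - y‖ := norm_sub_norm_le x y
    have h2 : |‖x - y‖ - ‖x‖| ≤ ‖y‖ := by
      have := abs_norm_sub_norm_le (x - y) x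
      simpa using this
    rw [hin h', one_mul]
    have h4 : 0 ≤ ‖y‖ * ‖x‖ ^ (-s - 1) := by positivity
    refine (abs_rpow_neg_sub_rpow_neg_le hs hx0 (by linarith [norm_nonneg y])).trans ?_
    calc s * 2 ^ (s + 1) * ‖x‖ ^ (-s - 1) * |‖x - y‖ - ‖x‖|
        ≤ s * 2 ^ (s + 1) * ‖x‖ ^ (-s - 1) * ‖y‖ := by gcongr
      _ = s * 2 ^ (s + 1) * (‖y‖ * ‖x‖ ^ (-s - 1)) := by ring
      _ ≤ _ := by gcongr; linarith

end Majorant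

/-! ### Uniform weighted bound for the majorant -/

section WeightedBound

variable {N : ℕ}

local notation "𝔼" => EuclideanSpace ℝ (Fin N)

/-- Three regions, with t = |y|: |x| ≤ t/2, where |x - y| is at least t/2; t/2 < |x| ≤ 4t, where |x|
is comparable to t; and |x| > 4t. In each, `hsum` makes the powers of t cancel. -/
theorem exists_lintegral_rieszMajorant_rpow_le (hN : 1 ≤ N) {s α β q : ℝ} (hs : 0 < s)
    (hα : α < 1) (hαβ : 0 < α + β) (hq : 1 ≤ q) (hβ : β * q < N)
    (hsum : (s + α + β) * q = N) :
    ∃ A : ℝ, ∀ y : 𝔼, y ≠ 0 →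
      ∫⁻ x, ENNReal.ofReal (rieszMajorant s x y * ‖x‖ ^ (-β) * ‖y‖ ^ (-α)) ^ q ≤
        ENNReal.ofReal A := by
  have hq0 : 0 < q := zero_lt_one.trans_le hq
  obtain ⟨C₁, hC₁, h₁⟩ := exists_lintegral_closedBall_rpow_le hN hβ
  obtain ⟨C₂, hC₂, h₂⟩ := exists_lintegral_closedBall_rpow_le hN (s := s * q) (by nlinarith)
  obtain ⟨C₃, hC₃, h₃⟩ := exists_lintegral_compl_ball_rpow_le hN (s := (s + 1 + β) * q)
    (by nlinarith)
  -- Since β may have either sign, D adds the values at both ends of t/2 ≤ |x| ≤ 4t.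
  set D : ℝ := (1 / 2) ^ (-(β * q)) + 4 ^ (-(β * q)) with hD
  refine ⟨(1 / 2) ^ (-(s * q)) * C₁ + (D * (C₂ * 5 ^ (N - s * q)) + C₃), fun y hy => ?_⟩
  set t := ‖y‖ with ht
  have ht0 : 0 < t := norm_pos_iff.2 hy
  have hp : ∀ a b c : ℝ, 0 ≤ a → 0 ≤ b → 0 ≤ c →
      (a ^ (-s) * b ^ (-β) * c ^ (-α)) ^ q = a ^ (-(s * q)) * b ^ (-(β * q)) * c ^ (-(α * q)) := by
    intro a b c ha hb hc
    rw [Real.mul_rpow (by positivity) (by positivity), Real.mul_rpow (by positivity) (by positivity),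
      ← Real.rpow_mul ha, ← Real.rpow_mul hb, ← Real.rpow_mul hc]
    simp only [neg_mul]
  -- The middle term is a function of x - y; its radius is 5t because |x - y| ≤ |x| + |y| ≤ 5t.
  have hpt : ∀ x : 𝔼, ENNReal.ofReal (rieszMajorant s x y * ‖x‖ ^ (-β) * t ^ (-α)) ^ q ≤
      (closedBall (0 : 𝔼) t).indicator (fun x =>
        ENNReal.ofReal ((t / 2) ^ (-(s * q)) * t ^ (-(α * q))) *
          ENNReal.ofReal (‖x‖ ^ (-(β * q)))) x +
      ((closedBall (0 : 𝔼) (5 * t)).indicator (fun x =>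
        ENNReal.ofReal (D * t ^ (-(β * q)) * t ^ (-(α * q))) *
          ENNReal.ofReal (‖x‖ ^ (-(s * q)))) (x - y) +
      {x : 𝔼 | t ≤ ‖x‖}.indicator (fun x =>
        ENNReal.ofReal (t ^ q * t ^ (-(α * q))) *
          ENNReal.ofReal (‖x‖ ^ (-((s + 1 + β) * q)))) x) := by
    intro x
    have hw := rieszMajorant_nonneg s x y
    rw [ENNReal.ofReal_rpow_of_nonneg (by positivity) hq0.le]
    unfold rieszMajorant
    have htri : ‖y‖ - ‖x‖ ≤ ‖x - y‖ := by rw [norm_sub_rev]; exact norm_sub_norm_le y x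
    have htri' : ‖x - y‖ ≤ ‖x‖ + ‖y‖ := norm_sub_le x y
    split_ifs with h
    · rw [hp _ _ _ (norm_nonneg _) (norm_nonneg _) ht0.le]
      rcases le_or_gt (2 * ‖x‖) t with hx | hx
      · refine le_trans ?_ le_self_add
        rw [indicator_of_mem (by simpa using by linarith [norm_nonneg x]),
          ← ENNReal.ofReal_mul (by positivity)]
        refine ENNReal.ofReal_le_ofReal ?_
        have : ‖x - y‖ ^ (-(s * q)) ≤ (t / 2) ^ (-(s * q)) :=
          Real.rpow_le_rpow_of_nonpos (by positivity) (by linarith)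
            (by have := mul_pos hs hq0; linarith)
        calc _ ≤ (t / 2) ^ (-(s * q)) * ‖x‖ ^ (-(β * q)) * t ^ (-(α * q)) := by gcongr
          _ = _ := by ring
      · refine le_trans ?_ (le_trans le_self_add le_add_self)
        rw [indicator_of_mem (by simpa using by linarith),
          ← ENNReal.ofReal_mul (by positivity)]
        refine ENNReal.ofReal_le_ofReal ?_
        have : ‖x‖ ^ (-(β * q)) ≤ D * t ^ (-(β * q)) := by
          rw [hD, add_mul, ← Real.mul_rpow (by norm_num) ht0.le,
            ← Real.mul_rpow (by norm_num) ht0.le]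
          have p1 : 0 ≤ (1 / 2 * t) ^ (-(β * q)) := by positivity
          have p2 : 0 ≤ (4 * t) ^ (-(β * q)) := by positivity
          rcases le_total 0 (-(β * q)) with hb | hb
          · have := Real.rpow_le_rpow (norm_nonneg x) h hb
            linarith
          · have := Real.rpow_le_rpow_of_nonpos (by positivity)
              (show 1 / 2 * t ≤ ‖x‖ by linarith) hb
            linarith
        calc _ ≤ ‖x - y‖ ^ (-(s * q)) * (D * t ^ (-(β * q))) * t ^ (-(α * q)) := by gcongr
          _ = _ := by ring
    · have h' : 4 * t < ‖x‖ := not_le.1 h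
      have hx0 : 0 < ‖x‖ := by linarith
      refine le_trans (le_of_eq ?_) (le_trans le_add_self le_add_self)
      rw [indicator_of_mem (show x ∈ {x : 𝔼 | t ≤ ‖x‖} from (by linarith : t ≤ ‖x‖)), ← ENNReal.ofReal_mul (by positivity)]
      congr 1
      rw [mul_assoc t, ← Real.rpow_add hx0, Real.mul_rpow (by positivity) (by positivity),
        Real.mul_rpow (by positivity) (by positivity), ← Real.rpow_mul ht0.le,
        ← Real.rpow_mul hx0.le]
      ring_nf
  have e1 : (t / 2) ^ (-(s * q)) * t ^ (-(α * q)) * (C₁ * t ^ (N - β * q)) =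
      (1 / 2) ^ (-(s * q)) * C₁ := by
    rw [show t / 2 = 1 / 2 * t by ring, Real.mul_rpow (by norm_num) ht0.le,
      show (N : ℝ) - β * q = s * q + α * q by linarith, Real.rpow_add ht0,
      Real.rpow_neg ht0.le, Real.rpow_neg ht0.le]
    field_simp
  have e2 : D * t ^ (-(β * q)) * t ^ (-(α * q)) * (C₂ * (5 * t) ^ (N - s * q)) =
      D * (C₂ * 5 ^ (N - s * q)) := by
    rw [Real.mul_rpow (by norm_num) ht0.le]
    nth_rewrite 2 [show (N : ℝ) - s * q = β * q + α * q by linarith]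
    rw [Real.rpow_add ht0, Real.rpow_neg ht0.le, Real.rpow_neg ht0.le]
    field_simp
  have e3 : t ^ q * t ^ (-(α * q)) * (C₃ * t ^ (N - (s + 1 + β) * q)) = C₃ := by
    rw [show (N : ℝ) - (s + 1 + β) * q = -q + α * q by linarith, Real.rpow_add ht0,
      Real.rpow_neg ht0.le, Real.rpow_neg ht0.le]
    field_simp
  have m1 : MeasurableSet {x : 𝔼 | t ≤ ‖x‖} := measurableSet_le measurable_const measurable_norm
  have m2 : ∀ r : ℝ, Measurable fun x : 𝔼 => ENNReal.ofReal (‖x‖ ^ r) := fun r =>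
    (measurable_norm.pow_const r).ennreal_ofReal
  have hDn : 0 ≤ D := by positivity
  refine (lintegral_mono hpt).trans ?_
  rw [lintegral_add_left (((m2 _).const_mul _).indicator measurableSet_closedBall),
    lintegral_add_right _ (((m2 _).const_mul _).indicator m1),
    lintegral_sub_right_eq_self (μ := (volume : Measure 𝔼)) _ y,
    lintegral_indicator measurableSet_closedBall, lintegral_indicator measurableSet_closedBall,
    lintegral_indicator m1, lintegral_const_mul _ (m2 _), lintegral_const_mul _ (m2 _),
    lintegral_const_mul _ (m2 _), ENNReal.ofReal_add (by positivity) (by positivity),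
    ENNReal.ofReal_add (by positivity) (by positivity)]
  have hmul : ∀ (a b : ℝ) (I : ENNReal), 0 ≤ a → I ≤ ENNReal.ofReal b →
      ENNReal.ofReal a * I ≤ ENNReal.ofReal (a * b) := fun a b I ha hI => by
    rw [ENNReal.ofReal_mul ha]
    exact mul_le_mul' le_rfl hI
  refine add_le_add ?_ (add_le_add ?_ ?_)
  · rw [← e1]
    exact hmul _ _ _ (by positivity) (h₁ t ht0)
  · rw [← e2]
    exact hmul _ _ _ (by positivity) (h₂ (5 * t) (by positivity))
  · rw [← e3]
    exact hmul _ _ _ (by positivity) (h₃ t ht0)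

end WeightedBound

/-! ### The Stein–Weiss inequality and its converse -/

section SteinWeiss

variable {N m : ℕ}

local notation "𝔼" => EuclideanSpace ℝ (Fin N)

theorem integrable_norm_sub_rpow_smul (hN : 1 ≤ N) {F : Type*} [NormedAddCommGroup F]
    [NormedSpace ℝ F] {s : ℝ} (hs : s < N) {f : 𝔼 → F} (hf : Continuous f)
    (hfs : HasCompactSupport f) (x : 𝔼) : Integrable fun y => ‖x - y‖ ^ (-s) • f y := by
  have h1 : LocallyIntegrable fun z : 𝔼 => ‖z‖ ^ (-s) :=
    locallyIntegrable_of_norm_le_rpow (by simpa) (α := s) (C := 1) (by simpa)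
      (.of_forall fun x => by simp [abs_of_nonneg (Real.rpow_nonneg (norm_nonneg x) (-s))])
      (measurable_norm.pow_const _).aestronglyMeasurable
  have h2 : Integrable fun z : 𝔼 => ‖z‖ ^ (-s) • f (x - z) :=
    h1.integrable_smul_right_of_hasCompactSupport (by fun_prop)
      (hfs.comp_homeomorph (Homeomorph.subLeft x))
  simpa using h2.comp_sub_left x

theorem rieszPotential_eq {F : Type*} [NormedAddCommGroup F] [NormedSpace ℂ F] (ℓ : ℝ)
    (f : 𝔼 → F) (x : 𝔼) :
    rieszPotential ℓ f x = rieszConst N ℓ • ∫ y, ‖x - y‖ ^ (-((N : ℝ) - ℓ)) • f y := by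
  simp only [rieszPotential, Real.rpow_neg (norm_nonneg _), one_div]

theorem HomDiffOp.Cocanceling.exists_enorm_rieszPotential_le {F V : Type*}
    [NormedAddCommGroup F] [NormedSpace ℂ F] [FiniteDimensional ℂ F]
    [NormedAddCommGroup V] [NormedSpace ℂ V] [FiniteDimensional ℂ V]
    (hN : 1 ≤ N) {L : HomDiffOp N m F V} (hL : L.Cocanceling) {ℓ : ℝ} (hℓ0 : 0 < ℓ)
    (hℓN : ℓ < N) :
    ∃ C : ℝ, 0 ≤ C ∧ ∀ f : 𝔼 → F, Continuous f → HasCompactSupport f → L.DistribZero f →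
      ∀ x : 𝔼, x ≠ 0 → ‖rieszPotential ℓ f x‖ₑ ≤
        ENNReal.ofReal C * ∫⁻ y, ENNReal.ofReal (rieszMajorant (N - ℓ) x y * ‖f y‖) := by
  set s : ℝ := N - ℓ with hs_def
  have hs : 0 < s := by linarith
  -- The radii match the thresholds 4|y| < |x| and |x| < 2|y| of the kernel estimate.
  let ψ : ContDiffBump (0 : 𝔼) := ⟨1 / 4, 1 / 2, by norm_num, by norm_num⟩
  obtain ⟨C, hC0, hC⟩ := hL.exists_norm_integral_bump_smul_le ψ
  set C₁ : ℝ := 1 + 2 ^ s + s * 2 ^ (s + 1)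
  have hC₁ : 0 ≤ C₁ := by positivity
  refine ⟨|rieszConst N ℓ| * (C₁ + C * 2 ^ s), by positivity, fun f hf hfs hLf x hx => ?_⟩
  have hr : 0 < ‖x‖ := norm_pos_iff.2 hx
  set u : F := ∫ y, ψ (‖x‖⁻¹ • y) • f y with hu
  set W := ∫⁻ y, ENNReal.ofReal (rieszMajorant s x y * ‖f y‖) with hW
  have hpull : ∀ c : ℝ, 0 ≤ c →
      ∫⁻ y, ENNReal.ofReal (c * (rieszMajorant s x y * ‖f y‖)) = ENNReal.ofReal c * W := by
    intro c hc
    rw [hW, ← lintegral_const_mul' _ _ ENNReal.ofReal_ne_top]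
    exact lintegral_congr fun y => ENNReal.ofReal_mul hc
  have hψint : Integrable fun y => (ψ (‖x‖⁻¹ • y) * ‖x‖ ^ (-s)) • f y :=
    Continuous.integrable_of_hasCompactSupport
      (((ψ.continuous.comp (continuous_const_smul _)).mul continuous_const).smul hf) hfs.smul_left
  have hsplit : ∫ y, ‖x - y‖ ^ (-s) • f y =
      (∫ y, (‖x - y‖ ^ (-s) - ψ (‖x‖⁻¹ • y) * ‖x‖ ^ (-s)) • f y) + ‖x‖ ^ (-s) • u := by
    rw [hu, ← integral_smul]
    simp only [sub_smul]
    rw [integral_sub (integrable_norm_sub_rpow_smul hN (by linarith) hf hfs x) hψint]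
    simp only [mul_comm (ψ _), mul_smul, sub_add_cancel]
  have hnorm : ∀ y : 𝔼, ‖‖x‖⁻¹ • y‖ = ‖y‖ / ‖x‖ := fun y => by
    rw [norm_smul, norm_inv, norm_norm, inv_mul_eq_div]
  have hfirst : ‖∫ y, (‖x - y‖ ^ (-s) - ψ (‖x‖⁻¹ • y) * ‖x‖ ^ (-s)) • f y‖ₑ ≤
      ENNReal.ofReal C₁ * W := by
    refine (enorm_integral_le_lintegral_enorm _).trans ?_
    rw [← hpull _ hC₁]
    refine lintegral_mono fun y => ?_
    rw [← ofReal_norm, norm_smul, Real.norm_eq_abs, ← mul_assoc]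
    refine ENNReal.ofReal_le_ofReal (mul_le_mul_of_nonneg_right ?_ (norm_nonneg _))
    refine abs_kernel_sub_le_rieszMajorant hs hx ψ.nonneg ψ.le_one (fun h => ?_) fun h => ?_
    · refine ψ.one_of_mem_closedBall ?_
      rw [mem_closedBall_zero_iff, hnorm, div_le_iff₀ hr]
      change _ ≤ 1 / 4 * _
      linarith
    · refine ψ.zero_of_le_dist ?_
      rw [dist_zero_right, hnorm, le_div_iff₀ hr]
      change 1 / 2 * _ ≤ _
      linarith
  have hsecond : ‖‖x‖ ^ (-s) • u‖ₑ ≤ ENNReal.ofReal (C * 2 ^ s) * W := by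
    rw [← hpull _ (by positivity), ← ofReal_norm, norm_smul,
      Real.norm_of_nonneg (by positivity)]
    refine (ENNReal.ofReal_le_ofReal
      (mul_le_mul_of_nonneg_left (hC f hf hfs hLf ‖x‖ hr) (by positivity))).trans ?_
    rw [← mul_assoc, ← integral_const_mul]
    refine (ENNReal.ofReal_le_ofReal (le_abs_self _)).trans ?_
    rw [← Real.norm_eq_abs, ofReal_norm]
    refine (enorm_integral_le_lintegral_enorm _).trans (lintegral_mono fun y => ?_)
    have hw := rieszMajorant_nonneg s x y
    by_cases hy : ‖y‖ ≤ ψ.rOut * ‖x‖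
    · rw [indicator_of_mem (by exact hy), Real.enorm_eq_ofReal (by positivity)]
      refine ENNReal.ofReal_le_ofReal ?_
      have hy' : ‖y‖ ≤ 1 / 2 * ‖x‖ := hy
      calc ‖x‖ ^ (-s) * C * (‖y‖ / ‖x‖ * ‖f y‖)
          = C * (‖y‖ * ‖x‖ ^ (-s - 1)) * ‖f y‖ := by
            rw [Real.rpow_sub_one hr.ne']; ring
        _ ≤ C * (2 ^ s * rieszMajorant s x y) * ‖f y‖ := by
            gcongr C * ?_ * ‖f y‖
            exact mul_rpow_le_rieszMajorant hs hx (by linarith)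
        _ = _ := by ring
    · rw [indicator_of_notMem (by exact hy)]
      simp
  rw [rieszPotential_eq, enorm_smul, Real.enorm_eq_ofReal_abs, ← hs_def, hsplit,
    ENNReal.ofReal_mul (abs_nonneg _), mul_assoc, ENNReal.ofReal_add hC₁ (by positivity), add_mul]
  gcongr
  exact (enorm_add_le _ _).trans (add_le_add hfirst hsecond)

theorem HomDiffOp.Cocanceling.steinWeissOnKernel {F V : Type*}
    [NormedAddCommGroup F] [NormedSpace ℂ F] [FiniteDimensional ℂ F]
    [NormedAddCommGroup V] [NormedSpace ℂ V] [FiniteDimensional ℂ V]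
    (hN : 1 ≤ N) {L : HomDiffOp N m F V} (hL : L.Cocanceling) {ℓ α β q : ℝ} (hℓ0 : 0 < ℓ)
    (hℓN : ℓ < N) (hα1 : α < 1) (hβ : β < N / q) (hαβ : 0 < α + β)
    (hq : 1 / q = 1 + (α + β - ℓ) / N) (hq1 : 1 ≤ q) : SteinWeissOnKernel L ℓ α β q := by
  have hq0 : 0 < q := zero_lt_one.trans_le hq1
  have hN0 : (0 : ℝ) < N := by exact_mod_cast hN
  have hsum : ((N - ℓ) + α + β) * q = N := by
    field_simp at hq
    linarith
  obtain ⟨C, hC0, hC⟩ := hL.exists_enorm_rieszPotential_le hN hℓ0 hℓN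
  obtain ⟨A, hA⟩ := exists_lintegral_rieszMajorant_rpow_le hN (s := N - ℓ) (by linarith) hα1 hαβ
    hq1 ((lt_div_iff₀ hq0).1 hβ) hsum
  set K : ENNReal := ENNReal.ofReal C * ENNReal.ofReal A ^ (1 / q) with hK
  have hKtop : K ≠ ⊤ := ENNReal.mul_ne_top ENNReal.ofReal_ne_top
    (ENNReal.rpow_ne_top_of_nonneg (by positivity) ENNReal.ofReal_ne_top)
  -- Adding 1 keeps the constant positive even if K = 0.
  refine ⟨K.toReal + 1, by positivity, fun f hf hfs hLf => ?_⟩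
  unfold SteinWeissIneq
  have : Nontrivial 𝔼 := Module.nontrivial_of_finrank_pos (R := ℝ) (by simpa using by omega)
  have hne : ∀ᵐ x : 𝔼, x ≠ 0 := by simp [ae_iff]
  set h : 𝔼 → 𝔼 → ENNReal := fun x y =>
    ENNReal.ofReal (rieszMajorant (N - ℓ) x y * ‖x‖ ^ (-β) * ‖y‖ ^ (-α)) with hh
  set g : 𝔼 → ENNReal := fun y => ENNReal.ofReal (‖y‖ ^ α * ‖f y‖) with hg
  have hhm : Measurable (Function.uncurry h) :=
    (((measurable_rieszMajorant _).mul
      ((by fun_prop : Measurable fun p : 𝔼 × 𝔼 => ‖p.1‖).pow_const _)).mul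
      ((by fun_prop : Measurable fun p : 𝔼 × 𝔼 => ‖p.2‖).pow_const _)).ennreal_ofReal
  have hgm : Measurable g :=
    ((measurable_norm.pow_const _).mul hf.continuous.norm.measurable).ennreal_ofReal
  have hpt : ∀ᵐ x : 𝔼, ENNReal.ofReal (‖rieszPotential ℓ f x‖ ^ q * ‖x‖ ^ (-β * q)) ≤
      ENNReal.ofReal C ^ q * (∫⁻ y, h x y * g y) ^ q := by
    filter_upwards [hne] with x hx
    have h1 : ∫⁻ y, h x y * g y = ENNReal.ofReal (‖x‖ ^ (-β)) *
        ∫⁻ y, ENNReal.ofReal (rieszMajorant (N - ℓ) x y * ‖f y‖) := by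
      rw [← lintegral_const_mul' _ _ ENNReal.ofReal_ne_top]
      refine lintegral_congr_ae ?_
      filter_upwards [hne] with y hy
      have hy0 : 0 < ‖y‖ := norm_pos_iff.2 hy
      have hw := rieszMajorant_nonneg (N - ℓ) x y
      rw [hh, hg, ← ENNReal.ofReal_mul (by positivity), ← ENNReal.ofReal_mul (by positivity),
        Real.rpow_neg hy0.le]
      congr 1
      field_simp
    rw [Real.rpow_mul (norm_nonneg _), ← Real.mul_rpow (by positivity) (by positivity),
      ← ENNReal.ofReal_rpow_of_nonneg (by positivity) hq0.le,
      ← ENNReal.mul_rpow_of_nonneg _ _ hq0.le, h1]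
    refine ENNReal.rpow_le_rpow ?_ hq0.le
    rw [mul_comm, ENNReal.ofReal_mul (by positivity), ofReal_norm, mul_left_comm]
    gcongr
    exact hC f hf.continuous hfs hLf x hx
  have hA' : ∀ᵐ y : 𝔼, ∫⁻ x, h x y ^ q ≤ ENNReal.ofReal A := by
    filter_upwards [hne] with y hy using hA y hy
  have hmain : ∫⁻ x, ENNReal.ofReal (‖rieszPotential ℓ f x‖ ^ q * ‖x‖ ^ (-β * q)) ≤
      ENNReal.ofReal C ^ q * (ENNReal.ofReal A * (∫⁻ y, g y) ^ q) := by
    refine (lintegral_mono_ae hpt).trans ?_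
    rw [lintegral_const_mul' _ _ (ENNReal.rpow_ne_top_of_nonneg hq0.le ENNReal.ofReal_ne_top)]
    gcongr
    exact lintegral_rpow_lintegral_mul_le volume volume hq1 hhm hgm hA'
  refine (ENNReal.rpow_le_rpow hmain (by positivity)).trans ?_
  rw [ENNReal.mul_rpow_of_nonneg _ _ (by positivity), ENNReal.mul_rpow_of_nonneg _ _ (by positivity),
    ← ENNReal.rpow_mul, ← ENNReal.rpow_mul, mul_one_div_cancel hq0.ne', ENNReal.rpow_one,
    ENNReal.rpow_one, ← mul_assoc]
  gcongr
  rw [ENNReal.ofReal_add ENNReal.toReal_nonneg zero_le_one, ENNReal.ofReal_toReal hKtop]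
  exact le_self_add

/-- For each functional φ, φ(L(ξ)e) is a polynomial in ξ with coefficients φ(b_γ e). It vanishes on
a product of infinite sets, hence identically. -/
theorem HomDiffOp.coeff_apply_eq_zero_of_symbol {F V : Type*} [AddCommGroup F] [Module ℂ F]
    [AddCommGroup V] [Module ℂ V] (hN : 1 ≤ N) {L : HomDiffOp N m F V} {e : F}
    (he : ∀ ξ : 𝔼, ξ ≠ 0 → L.symbol ξ e = 0) (γ : multiIndices N m) : L.coeff γ e = 0 := by
  rw [← Module.forall_dual_apply_eq_zero_iff ℂ]
  intro φ
  let p : MvPolynomial (Fin N) ℂ := ∑ δ : multiIndices N m,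
    MvPolynomial.monomial (Finsupp.equivFunOnFinite.symm δ.1) (φ (L.coeff δ e))
  have hp : p = 0 := by
    -- Nonzero real coordinates keep ξ ≠ 0, as N ≥ 1.
    refine MvPolynomial.funext_set (fun _ => (fun t : ℝ => (t : ℂ)) '' {t | t ≠ 0})
      (fun _ => ?_) fun z hz => ?_
    · exact (finite_singleton (0 : ℝ)).infinite_compl.image Complex.ofReal_injective.injOn
    · choose ξ hξ0 hξ using fun i => hz i (mem_univ i)
      have h0 : WithLp.toLp 2 ξ ≠ (0 : 𝔼) := fun h =>
        hξ0 ⟨0, by omega⟩ (by simpa using congrArg (fun v : 𝔼 => v ⟨0, by omega⟩) h)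
      have h1 := congrArg φ (he _ h0)
      simp only [HomDiffOp.symbol, LinearMap.sum_apply, LinearMap.smul_apply, map_sum, map_smul,
        map_zero, smul_eq_mul] at h1
      rw [map_zero, ← h1]
      simp only [p, map_sum, MvPolynomial.eval_monomial]
      refine Finset.sum_congr rfl fun δ _ => ?_
      rw [Finsupp.prod_fintype _ _ (by simp), mul_comm]
      simp [← hξ]
  have h2 := congrArg (MvPolynomial.coeff (Finsupp.equivFunOnFinite.symm γ.1)) hp
  simp only [p, MvPolynomial.coeff_sum, MvPolynomial.coeff_monomial, MvPolynomial.coeff_zero,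
    EmbeddingLike.apply_eq_iff_eq, Subtype.val_inj] at h2
  rwa [Finset.sum_ite_eq' Finset.univ γ, if_pos (Finset.mem_univ γ)] at h2

theorem HomDiffOp.cocanceling_of_steinWeissOnKernel {F V : Type*}
    [NormedAddCommGroup F] [NormedSpace ℂ F] [CompleteSpace F]
    [NormedAddCommGroup V] [NormedSpace ℂ V]
    (hN : 1 ≤ N) {L : HomDiffOp N m F V} {ℓ β q : ℝ} (hℓ0 : 0 < ℓ) (hℓN : ℓ < N) (hβ : 0 < β)
    (hq : 1 / q = 1 + (β - ℓ) / N) (h : SteinWeissOnKernel L ℓ 0 β q) : L.Cocanceling := by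
  have hN0 : (0 : ℝ) < N := by exact_mod_cast hN
  have hq0 : 0 < q := by
    have : 0 < 1 / q := by
      rw [hq, one_add_div hN0.ne']
      exact div_pos (by linarith) hN0
    simpa using this
  have hsum : ((N - ℓ) + β) * q = N := by
    field_simp at hq
    linarith
  set s : ℝ := N - ℓ with hs_def
  have hs : 0 < s := by linarith
  obtain ⟨C, -, hC⟩ := h
  unfold HomDiffOp.Cocanceling
  rw [eq_bot_iff]
  intro e he
  simp only [Submodule.mem_iInf, LinearMap.mem_ker, Subtype.forall] at he
  by_contra he0
  have hcoeff := HomDiffOp.coeff_apply_eq_zero_of_symbol hN he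
  have he0 : 0 < ‖e‖ := norm_pos_iff.2 he0
  let ψ : ContDiffBump (0 : 𝔼) := ⟨1 / 2, 1, by norm_num, by norm_num⟩
  set f : 𝔼 → F := fun x => ψ x • e with hf
  have hfc : ContDiff ℝ ∞ f := ψ.contDiff.smul contDiff_const
  have hfs : HasCompactSupport f := ψ.hasCompactSupport.smul_right
  have hLf : L.DistribZero f := by
    intro φ _ _
    refine Finset.sum_eq_zero fun γ _ => ?_
    have : ∀ x, L.coeff γ (f x) = 0 := fun x => by
      rw [hf]
      exact ((L.coeff γ).map_smul_of_tower (ψ x) e).trans (by rw [hcoeff γ, smul_zero])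
    simp [this]
  have hineq := hC f hfc hfs hLf
  unfold SteinWeissIneq at hineq
  have hrhs : ENNReal.ofReal C * ∫⁻ x, ENNReal.ofReal (‖x‖ ^ (0 : ℝ) * ‖f x‖) ≠ ⊤ := by
    refine ENNReal.mul_ne_top ENNReal.ofReal_ne_top ?_
    simp only [Real.rpow_zero, one_mul]
    exact (hfc.continuous.integrable_of_hasCompactSupport hfs).norm.lintegral_lt_top.ne
  have hconst : 0 < rieszConst N ℓ := by
    unfold rieszConst
    have h1 := Real.Gamma_pos_of_pos (half_pos hs)
    have h2 := Real.Gamma_pos_of_pos (half_pos hℓ0)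
    have := Real.pi_pos
    positivity
  have hc : 0 < ∫ y, ψ y := ψ.integral_pos
  set M : ℝ := rieszConst N ℓ * (2 ^ (-s) * (∫ y, ψ y) * ‖e‖) with hM
  have hM0 : 0 < M := by positivity
  have hlower : ∀ x : 𝔼, 1 < ‖x‖ → M * ‖x‖ ^ (-s) ≤ ‖rieszPotential ℓ f x‖ := by
    intro x hx
    -- On the support of ψ, |x - y| ≤ |x| + 1 ≤ 2|x|.
    have h1 : (2 * ‖x‖) ^ (-s) * ∫ y, ψ y ≤ ∫ y, ‖x - y‖ ^ (-s) • ψ y := by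
      rw [← integral_const_mul]
      refine integral_mono (ψ.integrable.const_mul _)
        (integrable_norm_sub_rpow_smul hN (by linarith) ψ.continuous ψ.hasCompactSupport x)
        fun y => ?_
      rcases le_or_gt 1 ‖y‖ with hy | hy
      · have : ψ y = 0 := ψ.zero_of_le_dist (by simpa using hy)
        simp [this]
      · refine mul_le_mul_of_nonneg_right ?_ ψ.nonneg
        have h2 : ‖x‖ - ‖y‖ ≤ ‖x - y‖ := norm_sub_norm_le x y
        have h3 : ‖x - y‖ ≤ ‖x‖ + ‖y‖ := norm_sub_le x y
        exact Real.rpow_le_rpow_of_nonpos (by linarith) (by linarith) (by linarith)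
    have h2 : ∫ y, ‖x - y‖ ^ (-s) • f y = (∫ y, ‖x - y‖ ^ (-s) • ψ y) • e := by
      rw [← integral_smul_const]
      simp only [hf, smul_smul, smul_eq_mul]
    have h3 : 0 ≤ (2 * ‖x‖) ^ (-s) * ∫ y, ψ y := by positivity
    rw [rieszPotential_eq, ← hs_def, h2, norm_smul, norm_smul, Real.norm_of_nonneg hconst.le,
      Real.norm_of_nonneg (h3.trans h1)]
    calc M * ‖x‖ ^ (-s) = rieszConst N ℓ * ((2 * ‖x‖) ^ (-s) * (∫ y, ψ y) * ‖e‖) := by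
          rw [hM, Real.mul_rpow (by norm_num) (norm_nonneg _)]; ring
      _ ≤ _ := by gcongr
  have htop : ∫⁻ x, ENNReal.ofReal (‖rieszPotential ℓ f x‖ ^ q * ‖x‖ ^ (-β * q)) = ⊤ := by
    rw [eq_top_iff]
    calc ⊤ = ENNReal.ofReal (M ^ q) *
          ∫⁻ x in {x : 𝔼 | 1 < ‖x‖}, ENNReal.ofReal (‖x‖ ^ (-(N : ℝ))) := by
          rw [lintegral_norm_rpow_neg_dim_eq_top hN one_pos, ENNReal.mul_top]
          simpa using by positivity
      _ = ∫⁻ x in {x : 𝔼 | 1 < ‖x‖}, ENNReal.ofReal (M ^ q) *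
            ENNReal.ofReal (‖x‖ ^ (-(N : ℝ))) :=
          (lintegral_const_mul' _ _ ENNReal.ofReal_ne_top).symm
      _ ≤ ∫⁻ x in {x : 𝔼 | 1 < ‖x‖},
            ENNReal.ofReal (‖rieszPotential ℓ f x‖ ^ q * ‖x‖ ^ (-β * q)) := by
          refine setLIntegral_mono' (measurableSet_lt measurable_const measurable_norm)
            fun x (hx : 1 < ‖x‖) => ?_
          have hx0 : 0 < ‖x‖ := by linarith
          rw [← ENNReal.ofReal_mul (by positivity)]
          refine ENNReal.ofReal_le_ofReal ?_
          -- Here (s + β)q = N, so the lower bound is exactly at the critical power.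
          calc M ^ q * ‖x‖ ^ (-(N : ℝ)) = (M * ‖x‖ ^ (-s)) ^ q * ‖x‖ ^ (-β * q) := by
                rw [Real.mul_rpow hM0.le (by positivity), ← Real.rpow_mul hx0.le, mul_assoc,
                  ← Real.rpow_add hx0]
                congr 2
                linarith
            _ ≤ _ := by
                gcongr
                exact hlower x hx
      _ ≤ _ := setLIntegral_le_lintegral _ _
  rw [htop, ENNReal.top_rpow_of_pos (by positivity)] at hineq
  exact hrhs (top_le_iff.1 hineq)

end SteinWeiss

theorem mainTheorem1 {F V : Type*}
    [NormedAddCommGroup F] [NormedSpace ℂ F] [FiniteDimensional ℂ F]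
    [NormedAddCommGroup V] [NormedSpace ℂ V] [FiniteDimensional ℂ V]
    (N m : ℕ) (hN : 2 ≤ N) (L : HomDiffOp N m F V)
    (ℓ α β q : ℝ) (hℓ0 : 0 < ℓ) (hℓN : ℓ < N) (hα0 : 0 ≤ α) (hα1 : α < 1)
    (hβ : β < N / q) (hαβ : 0 < α + β) (hq : 1 / q = 1 + (α + β - ℓ) / N) :
    (1 ≤ q → L.Cocanceling → SteinWeissOnKernel L ℓ α β q) ∧
    (α = 0 → SteinWeissOnKernel L ℓ 0 β q → L.Cocanceling) := by
  have hN1 : 1 ≤ N := one_le_two.trans hN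
  refine ⟨fun hq1 hL => hL.steinWeissOnKernel hN1 hℓ0 hℓN hα1 hβ hαβ hq hq1, ?_⟩
  have := FiniteDimensional.complete ℂ F
  rintro rfl h
  rw [zero_add] at hαβ hq
  exact HomDiffOp.cocanceling_of_steinWeissOnKernel hN1 hℓ0 hℓN hαβ hq h
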